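/- A Hausdorff topological group $(G,\mathcal T)$ with identity $0$ has the small subgroup generating property (SSGP) if for every neighbourhood $U$ of $0$ there is a family $\mathcal H$ of subgroups of $G$, each contained in $U$, such that the subgroup generated by $\bigcup\mathcal H$ is dense in $G$. An abelian group $G$ admits an SSGP topology if there is a Hausdorff group topology on $G$ with this property. For a set $P$ of primes, let $\mathbb Q_P$ be the subgroup of $\mathbb Q$ consisting of the fractions whose reduced denominator has all its prime factors in $P$. For a group $G$ and an infinite cardinal $\lambda$, $G^{(\lambda)}$ denotes the direct sum and $G^\lambda$ the direct product of $\lambda$ copies of $G$. **Theorem.** The following abelian groups admit an SSGP topology: (a) $\mathbb Q$, and $\mathbb Q_P$ for every infinite set $P$ of primes; (b) $\mathbb Q/\mathbb Z$, and $\mathbb Q_P/\mathbb Z$ for every infinite set $P$ of primes; (c) $\bigoplus_{i<\omega}\mathbb Z_{p_i}$, where the $p_i$ are primes that either all coincide or are pairwise distinct; (d) $\mathbb Z^{(\omega)}$; (e) $\mathbb Z^{\omega}$; (f) $G^{(\lambda)}$ for every abelian group $G$ with $|G|>1$ and every cardinal $\lambda\ge\omega$; (g) $F^{\lambda}$ for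 every finite abelian group $F$ with $|F|>1$ and every cardinal $\lambda\ge\omega$; (h) $\bigoplus_{i\in I}G_i$ and $\prod_{i\in I}G_i$ for every family $(G_i)_{i\in I}$ of abelian groups each of which admits an SSGP topology. -/

import Mathlib

open Topology DirectSum

universe u₁ u₂ u₃ u₄ u₅ u₆

/-- The small subgroup generating property of a topological group, in additive notation: for each
neighbourhood `U` of `0` there is a family `𝓗` of subgroups contained in `U` whose union generates
a dense subgroup. -/
def IsSSGP (G : Type*) [AddGroup G] [TopologicalSpace G] : Prop :=
  ∀ U ∈ 𝓝 (0 : G), ∃ 𝓗 : Set (AddSubgroup G),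
    (∀ H ∈ 𝓗, (H : Set G) ⊆ U) ∧
      Dense ((AddSubgroup.closure (⋃ H ∈ 𝓗, (H : Set G)) : AddSubgroup G) : Set G)

/-- The (abstract) group `G` admits an SSGP topology: there is a Hausdorff group topology on `G`
with the small subgroup generating property. (A Hausdorff group topology is automatically
completely regular.) -/
def AdmitsSSGP (G : Type*) [AddGroup G] : Prop :=
  ∃ _ : TopologicalSpace G, IsTopologicalAddGroup G ∧ T2Space G ∧ IsSSGP G

/-- For a set `P` of primes, the subgroup of `ℚ` of all fractions whose reduced denominator
has all its prime factors in `P`; the primes outside `P` are excluded from denominators, and the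
primes in `P` are allowed together with all their powers. -/
def ratDenomIn (P : Set ℕ) : AddSubgroup ℚ where
  carrier := {q | ∀ p : ℕ, p.Prime → p ∣ q.den → p ∈ P}
  zero_mem' := by
    intro p hp h
    exact absurd (Nat.dvd_one.mp h) hp.ne_one
  add_mem' := by
    intro a b ha hb p hp h
    rcases (Nat.Prime.dvd_mul hp).mp (h.trans (Rat.add_den_dvd a b)) with h | h
    · exact ha p hp h
    · exact hb p hp h
  neg_mem' := by
    intro a ha p hp h
    exact ha p hp (by simpa using h)

/-! The source of small subgroups is the group of functions from `ℝ` to a topological group `B`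
under convergence in measure (`MeasFun`). All functions supported on one short interval form a
subgroup near 0, whatever their values, and a step function on a long interval is a sum of step
functions on short ones. A group therefore gets an SSGP topology by pulling back along a
homomorphism into `MeasFun B`, or a power of it, provided that the image is separated and that its
short steps approximate all its elements (`admitsSSGP_of_hom`).

Two embeddings do the work. If `G` lies between `B₀^(Λ)` and `B^(Λ)` with `B₀` dense in `B` and `Λ`
infinite, reindexing `Λ` gives coordinates that can be used as values on the intervals `[0, q)`;
differences then give all short steps (`admitsSSGP_of_finsupp`). This covers `G^(Λ)` with `B = G`
discrete, and `ℤ^ω`, which lies between `ℤ^(I)` and `ℚ^(I)`, with `B` the circle. If instead `G` has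
coordinates in the circle that are primary for distinct primes, the coordinates are placed on
rational intervals each used infinitely often, and the growing primes make the available values
dense (`admitsSSGP_of_characters`). This covers `ℚ_P/ℤ` and sums of `ℤ_p` for distinct `p`.

For `ℚ_P` the same map kills `ℤ`, so an increasing sequence of such topologies, rescaled by powers
of one prime, is used. Powers of finite groups reduce to direct sums because `(ℤ/n)^Λ` is free over
`ℤ/n`. -/

/-! ### The small subgroup generating property of induced topologies -/

/-- The subgroup generated by the elements of `S` whose cyclic subgroups lie in `U`. -/
def smallGen {H : Type*} [AddGroup H] (U : Set H) (S : AddSubgroup H) : AddSubgroup H :=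
  AddSubgroup.closure {h | h ∈ S ∧ (AddSubgroup.zmultiples h : Set H) ⊆ U}

theorem mem_smallGen {H : Type*} [AddGroup H] {U : Set H} {S : AddSubgroup H} {h : H}
    (hS : h ∈ S) (hU : ∀ n : ℤ, n • h ∈ U) : h ∈ smallGen U S := by
  refine AddSubgroup.subset_closure ⟨hS, ?_⟩
  rintro _ ⟨n, rfl⟩
  exact hU n

theorem IsSSGP.dense_smallGen {G : Type*} [AddGroup G] [TopologicalSpace G] (hG : IsSSGP G)
    {U : Set G} (hU : U ∈ 𝓝 0) : Dense (smallGen U ⊤ : Set G) := by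
  obtain ⟨𝓗, h₁, h₂⟩ := hG U hU
  refine h₂.mono (AddSubgroup.closure_le _ |>.2 ?_)
  refine Set.iUnion₂_subset fun H hH x hx => mem_smallGen trivial fun n => h₁ H hH ?_
  exact H.zsmul_mem hx n

/-- Closure in an induced topology is the preimage of the closure of the image, so density can be
tested in `H`. Cyclic subgroups suffice, as every subgroup is the union of its cyclic ones. -/
theorem isSSGP_induced {G H : Type*} [AddGroup G] [AddGroup H] [TopologicalSpace H]
    [IsTopologicalAddGroup H] (φ : G →+ H)
    (h : ∀ U ∈ 𝓝 (0 : H), φ.range ≤ (smallGen U φ.range).topologicalClosure) :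
    @IsSSGP G _ (TopologicalSpace.induced φ inferInstance) := by
  let : TopologicalSpace G := TopologicalSpace.induced φ inferInstance
  intro U hU
  rw [nhds_induced, map_zero] at hU
  obtain ⟨V, hV, hVU⟩ := hU
  refine ⟨{K | (K : Set G) ⊆ U}, fun _ h => h, fun g => ?_⟩
  rw [closure_induced]
  have hg : φ g ∈ closure (smallGen V φ.range : Set H) := h V hV ⟨g, rfl⟩
  refine closure_mono ?_ hg
  rw [← AddSubgroup.coe_map, SetLike.coe_subset_coe, smallGen, AddSubgroup.closure_le]
  rintro _ ⟨⟨x, rfl⟩, hx⟩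
  refine ⟨x, AddSubgroup.subset_closure ?_, rfl⟩
  refine Set.mem_biUnion (x := AddSubgroup.zmultiples x) ?_ (AddSubgroup.mem_zmultiples x)
  rintro _ ⟨n, rfl⟩
  exact hVU (hx ⟨n, (map_zsmul φ n x).symm⟩)

/-- Separation is asked only of the image, since `MeasFun` is not Hausdorff: functions that vanish
almost everywhere lie in every neighbourhood of 0. -/
theorem admitsSSGP_of_hom {G H : Type*} [AddGroup G] [AddGroup H] [TopologicalSpace H]
    [IsTopologicalAddGroup H] (φ : G →+ H)
    (hsep : ∀ g, (∀ U ∈ 𝓝 (0 : H), φ g ∈ U) → g = 0)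
    (h : ∀ U ∈ 𝓝 (0 : H), φ.range ≤ (smallGen U φ.range).topologicalClosure) :
    AdmitsSSGP G := by
  let : TopologicalSpace G := TopologicalSpace.induced φ inferInstance
  have : IsTopologicalAddGroup G := topologicalAddGroup_induced φ
  refine ⟨inferInstance, inferInstance, ?_, isSSGP_induced φ h⟩
  refine IsTopologicalAddGroup.t2Space_of_zero_sep fun g hg => ?_
  by_contra! hcon
  refine hg (hsep g fun U hU => ?_)
  refine hcon (φ ⁻¹' U) ?_
  rw [nhds_induced, map_zero]
  exact Filter.preimage_mem_comap hU

theorem AdmitsSSGP.of_addEquiv {G H : Type*} [AddGroup G] [AddGroup H] (e : G ≃+ H)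
    (hH : AdmitsSSGP H) : AdmitsSSGP G := by
  obtain ⟨_, _, _, hs⟩ := hH
  refine admitsSSGP_of_hom e.toAddMonoidHom ?_ fun U hU => ?_
  · intro g hg
    by_contra hne
    exact hg {e g}ᶜ (isOpen_compl_singleton.mem_nhds fun h => hne (by simpa using h.symm)) rfl
  · have : e.toAddMonoidHom.range = ⊤ := AddMonoidHom.range_eq_top.2 e.surjective
    rw [this]
    exact fun x _ => hs.dense_smallGen hU x

/-- A Hausdorff supremum of an increasing sequence of group topologies with the small subgroup
generating property has that property. -/
theorem admitsSSGP_of_antitone {G : Type*} [AddGroup G] (t : ℕ → TopologicalSpace G)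
    (ht : Antitone t) (hgrp : ∀ k, @IsTopologicalAddGroup G (t k) _)
    (hs : ∀ k, @IsSSGP G _ (t k))
    (hsep : ∀ g : G, g ≠ 0 → ∃ k, ∃ U ∈ @nhds G (t k) 0, g ∉ U) : AdmitsSSGP G := by
  let T : TopologicalSpace G := ⨅ k, t k
  have hT : IsTopologicalAddGroup G := topologicalAddGroup_iInf hgrp
  have hmem : ∀ (x : G) (U : Set G), U ∈ 𝓝 x ↔ ∃ k, U ∈ @nhds G (t k) x := by
    intro x U
    rw [nhds_iInf, Filter.mem_iInf_of_directed]
    exact Antitone.directed_ge fun a b hab => nhds_mono (ht hab)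
  refine ⟨T, hT, IsTopologicalAddGroup.t2Space_of_zero_sep fun g hg => ?_, fun U hU => ?_⟩
  · obtain ⟨k, U, hU, hgU⟩ := hsep g hg
    exact ⟨U, (hmem 0 U).2 ⟨k, hU⟩, hgU⟩
  · obtain ⟨k, hk⟩ := (hmem 0 U).1 hU
    refine ⟨{K | (K : Set G) ⊆ U}, fun _ h => h, fun g => ?_⟩
    rw [mem_closure_iff_nhds]
    intro V hV
    obtain ⟨l, hl⟩ := (hmem g V).1 hV
    -- The order on topologies puts finer ones below, so the topology of index `max k l` sees both
    -- neighbourhoods.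
    have hU' : U ∈ @nhds G (t (max k l)) 0 := nhds_mono (ht (le_max_left k l)) hk
    have hV' : V ∈ @nhds G (t (max k l)) g := nhds_mono (ht (le_max_right k l)) hl
    obtain ⟨𝓗, h₁, h₂⟩ := hs (max k l) U hU'
    have hd := (@mem_closure_iff_nhds G (t (max k l)) _ _).1 (h₂ g) V hV'
    refine hd.mono (Set.inter_subset_inter_right _ ?_)
    refine SetLike.coe_subset_coe.2 (AddSubgroup.closure_mono ?_)
    exact Set.biUnion_subset_biUnion_left fun H hH => h₁ H hH

/-! ### Direct sums and products -/

/-- Coordinate embeddings are continuous, so they carry small subgroups to small subgroups, and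
every element of the product is a limit of finite sums of coordinate vectors. The subgroup `S` lets
one argument serve both the sum and the product. -/
theorem topologicalClosure_smallGen_pi {I : Type*} {G : I → Type*} [∀ i, AddCommGroup (G i)]
    [∀ i, TopologicalSpace (G i)] [∀ i, IsTopologicalAddGroup (G i)] (hs : ∀ i, IsSSGP (G i))
    (S : AddSubgroup (∀ i, G i)) [DecidableEq I] (hS : ∀ i g, Pi.single i g ∈ S)
    {U : Set (∀ i, G i)} (hU : U ∈ 𝓝 0) : (smallGen U S).topologicalClosure = ⊤ := by
  have hsingle : ∀ i (g : G i), Pi.single i g ∈ (smallGen U S).topologicalClosure := by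
    intro i g
    have hc : Continuous (Pi.single i : G i → ∀ j, G j) := continuous_single i
    have hpre : (Pi.single i : G i → ∀ j, G j) ⁻¹' U ∈ 𝓝 (0 : G i) :=
      hc.continuousAt.preimage_mem_nhds (by simpa using hU)
    have hle : smallGen ((Pi.single i : G i → ∀ j, G j) ⁻¹' U) ⊤ ≤
        (smallGen U S).comap (AddMonoidHom.single G i) := by
      refine (AddSubgroup.closure_le _).2 ?_
      rintro x ⟨-, hx⟩
      refine mem_smallGen (hS i x) fun n => ?_
      have := hx (AddSubgroup.zsmul_mem_zmultiples x n)
      rwa [Set.mem_preimage, Pi.single_zsmul] at this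
    exact map_mem_closure hc ((hs i).dense_smallGen hpre g) fun x hx => hle hx
  refine (AddSubgroup.eq_top_iff' _).2 fun h => ?_
  have hsum : HasSum (fun i => (Pi.single i (h i) : ∀ j, G j)) h := by
    refine Pi.hasSum.2 fun j => ?_
    convert hasSum_single (f := fun i => (Pi.single i (h i) : ∀ j, G j) j) j ?_ using 1
    · simp
    · intro i hij
      simp [Pi.single_eq_of_ne hij.symm]
  refine (AddSubgroup.isClosed_topologicalClosure _).mem_of_tendsto hsum ?_
  exact Filter.Eventually.of_forall fun s => AddSubgroup.sum_mem _ fun i _ => hsingle i _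

theorem admitsSSGP_directSum_and_pi {I : Type*} {G : I → Type*} [∀ i, AddCommGroup (G i)]
    (h : ∀ i, AdmitsSSGP (G i)) : AdmitsSSGP (⨁ i, G i) ∧ AdmitsSSGP (∀ i, G i) := by
  classical
  choose t ht₁ ht₂ hs using h
  have hsep : ∀ x : ∀ i, G i, (∀ U ∈ 𝓝 (0 : ∀ i, G i), x ∈ U) → x = 0 := by
    intro x hx
    by_contra hne
    exact hx {x}ᶜ (isOpen_compl_singleton.mem_nhds (by simpa [eq_comm] using hne)) rfl
  constructor
  · refine admitsSSGP_of_hom (DirectSum.coeFnAddMonoidHom G) (fun g hg => ?_) fun U hU => ?_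
    · exact DFunLike.coe_injective (hsep _ hg)
    · rw [topologicalClosure_smallGen_pi hs _ (fun i g => ?_) hU]
      · exact le_top
      · exact ⟨DirectSum.of G i g, DFinsupp.single_eq_pi_single⟩
  · refine admitsSSGP_of_hom (AddMonoidHom.id _) hsep fun U hU => ?_
    rw [topologicalClosure_smallGen_pi hs _ (fun i g => AddMonoidHom.mem_range.2 ⟨_, rfl⟩) hU]
    exact le_top

/-! ### Functions with the topology of convergence in measure -/

/-- The group of all functions `ℝ → B`, with the topology of convergence in Lebesgue (outer)
measure. -/
def MeasFun (B : Type*) : Type _ := ℝ → B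

namespace MeasFun

/-- The functions with values in `V` off a set of measure less than `ε`. -/
def nhdSet {B : Type*} (V : Set B) (ε : ENNReal) : Set (MeasFun B) :=
  {f | MeasureTheory.volume {x : ℝ | f x ∉ V} < ε}

theorem nhdSet_mono {B : Type*} {V W : Set B} {ε δ : ENNReal} (h : V ⊆ W) (h' : ε ≤ δ) :
    nhdSet V ε ⊆ nhdSet W δ := fun _ hf =>
  lt_of_le_of_lt (MeasureTheory.measure_mono (Set.compl_subset_compl.2 (Set.preimage_mono h)))
    (lt_of_lt_of_le hf h')

variable {B : Type*} [AddCommGroup B]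

instance : AddCommGroup (MeasFun B) := inferInstanceAs (AddCommGroup (ℝ → B))

theorem add_apply (f g : MeasFun B) (x : ℝ) : (f + g) x = f x + g x := rfl

open Classical in
/-- The step function with value `b` on `[a, c)` and `0` elsewhere. -/
noncomputable def step (a c : ℚ) : B →+ MeasFun B where
  toFun b := fun x => if (a : ℝ) ≤ x ∧ x < c then b else 0
  map_zero' := by funext x; exact ite_self 0
  map_add' b b' := by
    funext x
    change _ = (if (a : ℝ) ≤ x ∧ x < c then b else 0) + (if (a : ℝ) ≤ x ∧ x < c then b' else 0)
    split_ifs <;> simp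

open Classical in
theorem step_apply (a c : ℚ) (b : B) (x : ℝ) :
    step a c b x = if (a : ℝ) ≤ x ∧ x < c then b else 0 := rfl

theorem step_add_step {a c d : ℚ} (h : a ≤ c) (h' : c ≤ d) (b : B) :
    step a c b + step c d b = step a d b := by
  funext x
  rw [add_apply, step_apply, step_apply, step_apply]
  have h1 : (a : ℝ) ≤ c := by exact_mod_cast h
  have h2 : (c : ℝ) ≤ d := by exact_mod_cast h'
  rcases lt_or_ge x c with hx | hx
  · have : ¬ (c : ℝ) ≤ x := not_le.2 hx
    simp [this, hx, hx.trans_le h2]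
  · have : ¬ x < (c : ℝ) := not_lt.2 hx
    simp [this, hx, h1.trans hx]

/-- A subgroup containing the step functions of value `b` on all short intervals contains those
on all intervals. -/
theorem step_mem_of_short (C : AddSubgroup (MeasFun B)) {b : B} {ε : ℚ} (hε : 0 < ε)
    {a c : ℚ} (hac : a < c)
    (h : ∀ a' c' : ℚ, a ≤ a' → a' < c' → c' - a' < ε → step a' c' b ∈ C) : step a c b ∈ C := by
  -- Cut the interval into `l` equal pieces, each shorter than `ε`.
  obtain ⟨l, hl⟩ := exists_nat_gt ((c - a) / ε)
  have hl0 : (0 : ℚ) < l := lt_trans (div_pos (sub_pos.2 hac) hε) hl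
  set d := (c - a) / l with hd
  have hd0 : 0 < d := div_pos (sub_pos.2 hac) hl0
  have hdε : d < ε := by
    rw [div_lt_iff₀ hε] at hl
    rw [hd, div_lt_iff₀ hl0]
    linarith
  have key : ∀ j : ℕ, step a (a + j * d) b ∈ C := by
    intro j
    induction j with
    | zero =>
      have : step a (a + (0 : ℕ) * d) b = 0 := by
        funext x
        rw [step_apply, if_neg]
        · rfl
        · simp
      rw [this]
      exact C.zero_mem
    | succ j ih =>
      have hj : a ≤ a + j * d := le_add_of_nonneg_right (mul_nonneg j.cast_nonneg hd0.le)
      rw [← step_add_step (c := a + j * d) hj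
        (by push_cast; linarith)]
      exact C.add_mem ih (h _ _ hj (by push_cast; linarith) (by push_cast; linarith))
  have := key l
  rwa [hd, mul_div_cancel₀ _ hl0.ne', add_sub_cancel] at this

variable [TopologicalSpace B] [IsTopologicalAddGroup B]

variable (B) in
/-- The filter basis at `0` of convergence in measure. -/
@[reducible]
def filterBasis : AddGroupFilterBasis (MeasFun B) where
  sets := {s | ∃ V ∈ 𝓝 (0 : B), ∃ ε : ENNReal, 0 < ε ∧ s = nhdSet V ε}
  nonempty := ⟨_, Set.univ, Filter.univ_mem, 1, one_pos, rfl⟩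
  inter_sets := by
    rintro _ _ ⟨V, hV, ε, hε, rfl⟩ ⟨W, hW, δ, hδ, rfl⟩
    exact ⟨_, ⟨V ∩ W, Filter.inter_mem hV hW, min ε δ, lt_min hε hδ, rfl⟩,
      Set.subset_inter (nhdSet_mono Set.inter_subset_left (min_le_left _ _))
        (nhdSet_mono Set.inter_subset_right (min_le_right _ _))⟩
  zero' := by
    rintro _ ⟨V, hV, ε, hε, rfl⟩
    have h0 : (0 : B) ∈ V := mem_of_mem_nhds hV
    change MeasureTheory.volume {x : ℝ | (0 : B) ∉ V} < ε
    simpa [h0] using hε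
  add' := by
    rintro _ ⟨V, hV, ε, hε, rfl⟩
    obtain ⟨W, hW, hWV⟩ := exists_nhds_zero_half hV
    refine ⟨_, ⟨W, hW, ε / 2, ENNReal.half_pos hε.ne', rfl⟩, ?_⟩
    rintro _ ⟨f, hf, g, hg, rfl⟩
    have hsub : {x : ℝ | (f + g) x ∉ V} ⊆ {x | f x ∉ W} ∪ {x | g x ∉ W} := by
      intro x hx
      by_contra hcon
      simp only [Set.mem_union, Set.mem_ofPred_eq, not_or, not_not] at hcon
      exact hx (hWV _ hcon.1 _ hcon.2)
    calc MeasureTheory.volume {x : ℝ | (f + g) x ∉ V}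
        ≤ _ := (MeasureTheory.measure_mono hsub).trans (MeasureTheory.measure_union_le _ _)
      _ < ε / 2 + ε / 2 := ENNReal.add_lt_add hf hg
      _ = ε := ENNReal.add_halves ε
  neg' := by
    rintro _ ⟨V, hV, ε, hε, rfl⟩
    exact ⟨_, ⟨-V, neg_mem_nhds_zero B hV, ε, hε, rfl⟩, fun f hf => hf⟩
  conj' := by
    rintro f _ hU
    exact ⟨_, hU, fun g hg => by simpa [add_comm f g] using hg⟩

instance : TopologicalSpace (MeasFun B) := (filterBasis B).topology

instance : IsTopologicalAddGroup (MeasFun B) := (filterBasis B).isTopologicalAddGroup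

theorem nhdSet_mem_nhds {V : Set B} (hV : V ∈ 𝓝 0) {ε : ENNReal} (hε : 0 < ε) :
    nhdSet V ε ∈ 𝓝 (0 : MeasFun B) :=
  (filterBasis B).mem_nhds_zero ⟨V, hV, ε, hε, rfl⟩

theorem exists_nhdSet_subset {U : Set (MeasFun B)} (hU : U ∈ 𝓝 0) :
    ∃ V ∈ 𝓝 (0 : B), ∃ ε : ENNReal, 0 < ε ∧ nhdSet V ε ⊆ U := by
  obtain ⟨_, ⟨V, hV, ε, hε, rfl⟩, h⟩ := (filterBasis B).nhds_zero_hasBasis.mem_iff.1 hU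
  exact ⟨V, hV, ε, hε, h⟩

theorem continuous_step (a c : ℚ) : Continuous (step a c : B →+ MeasFun B) := by
  refine continuous_of_continuousAt_zero _ fun U hU => ?_
  rw [map_zero] at hU
  obtain ⟨V, hV, ε, hε, hVU⟩ := exists_nhdSet_subset hU
  refine Filter.mem_map.2 (Filter.mem_of_superset hV fun b hb => hVU ?_)
  have : {x : ℝ | step a c b x ∉ V} = ∅ := by
    refine Set.eq_empty_of_forall_notMem fun x hx => hx ?_
    rw [step_apply]
    split_ifs
    exacts [hb, mem_of_mem_nhds hV]
  change MeasureTheory.volume {x : ℝ | step a c b x ∉ V} < ε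
  rwa [this, MeasureTheory.measure_empty]

/-- Step functions on short intervals are small. -/
theorem exists_step_mem {U : Set (MeasFun B)} (hU : U ∈ 𝓝 0) :
    ∃ ε : ℚ, 0 < ε ∧ ∀ a c : ℚ, c - a < ε → ∀ b : B, step a c b ∈ U := by
  obtain ⟨V, hV, ε, hε, hVU⟩ := exists_nhdSet_subset hU
  obtain ⟨δ, hδ, hδε⟩ : ∃ δ : ℚ, 0 < δ ∧ ENNReal.ofReal δ ≤ ε := by
    rcases eq_or_ne ε ⊤ with rfl | hne
    · exact ⟨1, one_pos, le_top⟩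
    · obtain ⟨δ, h0, h1⟩ := exists_rat_btwn (ENNReal.toReal_pos hε.ne' hne)
      exact ⟨δ, by exact_mod_cast h0, ENNReal.ofReal_le_of_le_toReal h1.le⟩
  refine ⟨δ, hδ, fun a c hac b => hVU ?_⟩
  -- The exceptional set lies in the interval whatever `b` is; this uniformity makes whole subgroups
  -- small.
  have hsub : {x : ℝ | step a c b x ∉ V} ⊆ Set.Ico (a : ℝ) c := by
    intro x hx
    by_contra hcon
    refine hx ?_
    rw [step_apply, if_neg (show ¬ ((a : ℝ) ≤ x ∧ x < c) from hcon)]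
    exact mem_of_mem_nhds hV
  refine lt_of_le_of_lt (MeasureTheory.measure_mono hsub) (lt_of_lt_of_le ?_ hδε)
  rw [Real.volume_Ico]
  exact (ENNReal.ofReal_lt_ofReal_iff (by exact_mod_cast hδ)).2 (by exact_mod_cast hac)

/-- A function in every neighbourhood of `0` that is constant on an interval vanishes there. -/
theorem eq_zero_of_const [T1Space B] {f : MeasFun B} (hf : ∀ U ∈ 𝓝 (0 : MeasFun B), f ∈ U)
    {a c : ℝ} (hac : a < c) {b : B} (hb : ∀ x, a ≤ x → x < c → f x = b) : b = 0 := by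
  by_contra hne
  have hV : ({b}ᶜ : Set B) ∈ 𝓝 0 := isOpen_compl_singleton.mem_nhds (Ne.symm hne)
  have hpos : 0 < MeasureTheory.volume (Set.Ico a c) := by simpa using hac
  have h := hf _ (nhdSet_mem_nhds hV hpos)
  refine absurd h (not_lt.2 (MeasureTheory.measure_mono fun x hx => ?_))
  simpa using hb x hx.1 hx.2

end MeasFun

/-! ### Groups between `B₀^(Λ)` and `B^(Λ)` with `B₀` dense in `B` -/

namespace MeasFun

/-- Evaluation at a point. -/
def evalHom (B : Type*) [AddCommGroup B] (x : ℝ) : MeasFun B →+ B := Pi.evalAddMonoidHom _ x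

open Classical in
/-- The sum of the step functions of values `f (i, q)` on `[0, q)`, for each `i`. -/
noncomputable def stepSum (I B : Type*) [AddCommGroup B] :
    (I × {q : ℚ // 0 < q} →₀ B) →+ (I → MeasFun B) :=
  Finsupp.liftAddHom fun p =>
    (AddMonoidHom.single (fun _ : I => MeasFun B) p.1).comp (step 0 p.2)

open Classical in
theorem stepSum_single {I B : Type*} [AddCommGroup B] (p : I × {q : ℚ // 0 < q}) (b : B) :
    stepSum I B (Finsupp.single p b) = Pi.single p.1 (step 0 (p.2 : ℚ) b) := by
  simp [stepSum]

open Classical in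
theorem stepSum_apply {I B : Type*} [AddCommGroup B] (f : I × {q : ℚ // 0 < q} →₀ B) (i : I)
    (x : ℝ) : stepSum I B f i x =
      ∑ p ∈ f.support, if p.1 = i ∧ 0 ≤ x ∧ x < (p.2 : ℚ) then f p else 0 := by
  have h : stepSum I B f i x =
      ((evalHom B x).comp (Pi.evalAddMonoidHom (fun _ : I => MeasFun B) i)) (stepSum I B f) := rfl
  rw [h, stepSum, Finsupp.liftAddHom_apply, Finsupp.sum, map_sum]
  refine Finset.sum_congr rfl fun p _ => ?_
  change (Pi.single p.1 (step 0 (p.2 : ℚ) (f p)) : I → MeasFun B) i x = _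
  rcases eq_or_ne p.1 i with rfl | hne
  · rw [Pi.single_eq_same, step_apply]
    simp
  · rw [Pi.single_eq_of_ne hne.symm, if_neg fun h => hne h.1]
    rfl

/-- In a coordinate `i` that occurs in the support, just below the largest right endpoint only one
step is nonzero, so the function is constant there with that nonzero value. -/
theorem eq_zero_of_stepSum {I B : Type*} [AddCommGroup B] [TopologicalSpace B]
    [IsTopologicalAddGroup B] [T1Space B] (f : I × {q : ℚ // 0 < q} →₀ B)
    (hf : ∀ U ∈ 𝓝 (0 : I → MeasFun B), stepSum I B f ∈ U) : f = 0 := by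
  classical
  by_contra hne
  obtain ⟨⟨i, q⟩, hp⟩ := Finsupp.support_nonempty_iff.2 hne
  obtain ⟨p₀, hp₀, hmax⟩ := (f.support.filter fun p => p.1 = i).exists_max_image
    (fun p => p.2) ⟨(i, q), by simpa using hp⟩
  rw [Finset.mem_filter] at hp₀
  obtain ⟨r, hr0, hr, hrp⟩ : ∃ r : ℚ, 0 ≤ r ∧ r < p₀.2 ∧
      ∀ p ∈ f.support, p.1 = i → p ≠ p₀ → (p.2 : ℚ) ≤ r := by
    -- The point 0 is added so that the maximum exists and `[r, p₀.2)` stays inside `[0, p₀.2)`.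
    let T : Finset ℚ := insert 0 (((f.support.filter fun p => p.1 = i).erase p₀).image
      fun p => (p.2 : ℚ))
    have hT : T.Nonempty := Finset.insert_nonempty _ _
    refine ⟨T.max' hT, T.le_max' _ (Finset.mem_insert_self _ _), ?_, ?_⟩
    · rw [Finset.max'_lt_iff]
      intro y hy
      rcases Finset.mem_insert.1 hy with rfl | hy
      · exact p₀.2.2
      · obtain ⟨p, hp, rfl⟩ := Finset.mem_image.1 hy
        obtain ⟨hpp, hp⟩ := Finset.mem_erase.1 hp
        refine lt_of_le_of_ne (hmax p hp) fun h => hpp ?_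
        exact Prod.ext ((Finset.mem_filter.1 hp).2.trans hp₀.2.symm) (Subtype.ext h)
    · intro p hp hpi hpp
      exact T.le_max' _ (Finset.mem_insert_of_mem (Finset.mem_image_of_mem _
        (Finset.mem_erase.2 ⟨hpp, Finset.mem_filter.2 ⟨hp, hpi⟩⟩)))
  have hfi : ∀ U ∈ 𝓝 (0 : MeasFun B), stepSum I B f i ∈ U := fun U hU =>
    hf _ ((continuous_apply i).continuousAt.preimage_mem_nhds hU)
  refine Finsupp.mem_support_iff.1 hp₀.1 (eq_zero_of_const (a := r) (c := (p₀.2 : ℚ)) hfi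
    (by exact_mod_cast hr) fun x hx hx' => ?_)
  have hx0 : 0 ≤ x := le_trans (by exact_mod_cast hr0) hx
  rw [stepSum_apply, Finset.sum_eq_single_of_mem p₀ hp₀.1, if_pos ⟨hp₀.2, hx0, hx'⟩]
  intro p hp hpp
  refine if_neg fun h => ?_
  have : ((p.2 : ℚ) : ℝ) ≤ r := by exact_mod_cast hrp p hp h.1 hpp
  linarith [h.2.2]

end MeasFun

open MeasFun in
-- The image contains all `B₀`-valued steps on `[0, q)`, hence by subtraction those on short
-- intervals, which lie in small cyclic subgroups. Density of `B₀` and continuity of `step` pass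
-- from `B₀`-valued to `B`-valued steps.
theorem admitsSSGP_of_finsupp {G I B : Type*} [AddCommGroup G] [AddCommGroup B]
    [TopologicalSpace B] [IsTopologicalAddGroup B] [T1Space B] {B₀ : AddSubgroup B}
    (hB₀ : Dense (B₀ : Set B)) (φ : G →+ (I × {q : ℚ // 0 < q} →₀ B))
    (hφ : Function.Injective φ) (hr : ∀ p, ∀ b ∈ B₀, Finsupp.single p b ∈ φ.range) :
    AdmitsSSGP G := by
  classical
  refine admitsSSGP_of_hom ((stepSum I B).comp φ) (fun g hg => ?_) fun U hU => ?_
  · exact hφ ((eq_zero_of_stepSum _ hg).trans (map_zero φ).symm)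
  set S := ((stepSum I B).comp φ).range
  set C := (smallGen U S).topologicalClosure
  have hpref : ∀ (i : I) (c : ℚ), 0 ≤ c → ∀ b ∈ B₀,
      (Pi.single i (step 0 c b) : I → MeasFun B) ∈ S := by
    intro i c hc b hb
    rcases hc.eq_or_lt with rfl | hc
    · have : step 0 0 b = 0 := by
        funext x
        rw [step_apply, if_neg]
        · rfl
        · rintro ⟨h1, h2⟩
          exact absurd h2 (not_lt.2 h1)
      rw [this, Pi.single_zero]
      exact S.zero_mem
    · obtain ⟨g, hg⟩ := hr (i, ⟨c, hc⟩) b hb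
      exact ⟨g, by rw [AddMonoidHom.comp_apply, hg, stepSum_single]⟩
  have hsingle : ∀ (i : I) (q : ℚ), 0 < q → ∀ b,
      (Pi.single i (step 0 q b) : I → MeasFun B) ∈ C := by
    intro i q hq b
    have hcs : Continuous fun f : MeasFun B => (Pi.single i f : I → MeasFun B) :=
      continuous_single (A := fun _ => MeasFun B) i
    have hc : Continuous fun b : B => (Pi.single i (step 0 q b) : I → MeasFun B) :=
      hcs.comp (continuous_step 0 q)
    refine map_mem_closure (f := fun b : B => (Pi.single i (step 0 q b) : I → MeasFun B))
      (t := (smallGen U S : Set (I → MeasFun B))) hc (hB₀ b) fun b hb => ?_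
    obtain ⟨ε, hε, hsmall⟩ := exists_step_mem
      (hcs.continuousAt.preimage_mem_nhds (x := 0) (t := U) (by simpa using hU))
    refine step_mem_of_short
      ((smallGen U S).comap (AddMonoidHom.single (fun _ : I => MeasFun B) i)) hε hq
      fun a c ha hac hlt => mem_smallGen ?_ fun n => ?_
    · have h : step a c b = step 0 c b - step 0 a b :=
        eq_sub_of_add_eq' (step_add_step ha hac.le b)
      rw [h, map_sub]
      exact S.sub_mem (hpref i c (ha.trans hac.le) b hb) (hpref i a ha b hb)
    · rw [← map_zsmul, ← map_zsmul]
      exact hsmall a c hlt _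
  rintro _ ⟨g, rfl⟩
  rw [AddMonoidHom.comp_apply]
  induction φ g using Finsupp.induction_linear with
  | zero => rw [map_zero]; exact C.zero_mem
  | add f g hf hg => rw [map_add]; exact C.add_mem hf hg
  | single p b => rw [stepSum_single]; exact hsingle _ _ p.2.2 b

theorem nonempty_equiv_prod_pos_rat (I : Type*) [Infinite I] :
    Nonempty (I ≃ I × {q : ℚ // 0 < q}) := by
  have : Infinite {q : ℚ // 0 < q} := (Set.Ioi_infinite (0 : ℚ)).to_subtype
  rw [← Cardinal.lift_mk_eq', Cardinal.mk_prod, Cardinal.mk_eq_aleph0 {q : ℚ // 0 < q}]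
  simp

theorem admitsSSGP_finsupp (G Λ : Type*) [AddCommGroup G] [Infinite Λ] :
    AdmitsSSGP (Λ →₀ G) := by
  obtain ⟨e⟩ := nonempty_equiv_prod_pos_rat Λ
  let _ : TopologicalSpace G := ⊥
  have : DiscreteTopology G := ⟨rfl⟩
  let φ := (Finsupp.domCongr e : (Λ →₀ G) ≃+ _)
  refine admitsSSGP_of_finsupp (B₀ := ⊤) (by simp) φ.toAddMonoidHom φ.injective fun p b _ => ?_
  exact φ.surjective _

/-! ### The group `ℤ^ω` -/

/-- The embedding `r ↦ r√2` of `ℚ` into the circle. -/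
noncomputable def ratToCircle : ℚ →+ UnitAddCircle :=
  (QuotientAddGroup.mk' _).comp ((AddMonoidHom.mulRight (√2 : ℝ)).comp
    (Rat.castHom ℝ).toAddMonoidHom)

theorem ratToCircle_apply (r : ℚ) : ratToCircle r = ((r * √2 : ℝ) : UnitAddCircle) := rfl

theorem ratToCircle_injective : Function.Injective ratToCircle := by
  refine (injective_iff_map_eq_zero _).2 fun r hr => ?_
  rw [ratToCircle_apply, AddCircle.coe_eq_zero_iff] at hr
  obtain ⟨n, hn⟩ := hr
  by_contra hne
  exact (irrational_sqrt_two.ratCast_mul hne) ⟨n, by simpa using hn⟩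

theorem dense_ratToCircle_int :
    Dense (((ratToCircle.comp (Int.castAddHom ℚ)).range : AddSubgroup UnitAddCircle) :
      Set UnitAddCircle) := by
  have h := (AddCircle.denseRange_zsmul_coe_iff (p := (1 : ℝ)) (a := √2)).2
    (by simpa using irrational_sqrt_two)
  refine h.mono ?_
  rintro _ ⟨n, rfl⟩
  exact ⟨n, by simp [ratToCircle_apply]⟩

/-- Torsion-free groups of infinite rank, given by coordinates in a maximal independent set. -/
theorem admitsSSGP_of_rat_coordinates {G I : Type*} [AddCommGroup G] [Infinite I]
    (φ : G →+ (I →₀ ℚ)) (hφ : Function.Injective φ)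
    (hr : ∀ i, Finsupp.single i 1 ∈ φ.range) : AdmitsSSGP G := by
  obtain ⟨e⟩ := nonempty_equiv_prod_pos_rat I
  let ψ : (I →₀ ℚ) →+ (I × {q : ℚ // 0 < q} →₀ UnitAddCircle) :=
    (Finsupp.mapRange.addMonoidHom ratToCircle).comp
      (Finsupp.domCongr e : (I →₀ ℚ) ≃+ _).toAddMonoidHom
  have hψ : Function.Injective ψ :=
    (Finsupp.mapRange_injective _ (map_zero _) ratToCircle_injective).comp
      (Finsupp.domCongr e : (I →₀ ℚ) ≃+ _).injective
  -- `B₀` is the image of `ℤ` in the circle, dense because `√2` is irrational; the hypothesis `hr`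
  -- supplies exactly the integer multiples of unit vectors.
  refine admitsSSGP_of_finsupp dense_ratToCircle_int (ψ.comp φ) (hψ.comp hφ) ?_
  rintro p _ ⟨n, rfl⟩
  obtain ⟨g, hg⟩ := hr (e.symm p)
  refine ⟨n • g, ?_⟩
  rw [map_zsmul, AddMonoidHom.comp_apply, hg, ← map_zsmul]
  simp [ψ, Finsupp.domCongr]

/-- A maximal rationally independent set of integer sequences is a basis of their rational span.
Coordinates in it embed the group in `ℚ^(I)` and send the basis elements, which are themselves
integer sequences, to unit vectors. -/
theorem admitsSSGP_pi_int : AdmitsSSGP (ℕ → ℤ) := by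
  let c : (ℕ → ℤ) →+ (ℕ → ℚ) := (Int.castAddHom ℚ).compLeft ℕ
  have hc : Function.Injective c := fun f g h =>
    funext fun n => Int.cast_injective (α := ℚ) (congrFun h n)
  obtain ⟨b, hb, hspan, hli⟩ := exists_linearIndependent ℚ (Set.range c)
  have hmem : ∀ f, c f ∈ Submodule.span ℚ (Set.range ((↑) : b → ℕ → ℚ)) := fun f => by
    rw [Subtype.range_coe, hspan]
    exact Submodule.subset_span ⟨f, rfl⟩
  let β := Module.Basis.span hli
  have : Infinite b := by
    by_contra hfin
    rw [not_infinite_iff_finite] at hfin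
    have : FiniteDimensional ℚ (Submodule.span ℚ (Set.range ((↑) : b → ℕ → ℚ))) :=
      Module.Finite.of_basis β
    have hli : LinearIndependent ℚ fun n : ℕ =>
        (⟨c (Pi.single n 1), hmem _⟩ : Submodule.span ℚ (Set.range ((↑) : b → ℕ → ℚ))) := by
      refine LinearIndependent.of_comp (Submodule.subtype _) ?_
      convert Pi.linearIndependent_single_one ℕ ℚ using 1
      ext n m
      simp [c, Pi.single_apply]
    exact not_finite_iff_infinite.2 inferInstance hli.finite
  let φ : (ℕ → ℤ) →+ (b →₀ ℚ) := β.repr.toLinearMap.toAddMonoidHom.comp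
    (c.codRestrict (Submodule.span ℚ (Set.range ((↑) : b → ℕ → ℚ))) hmem)
  refine admitsSSGP_of_rat_coordinates φ (fun f g h => hc ?_) fun i => ?_
  · exact congrArg Subtype.val (β.repr.injective h)
  · obtain ⟨f, hf⟩ := hb i.2
    refine ⟨f, ?_⟩
    have : (⟨c f, hmem f⟩ : Submodule.span ℚ (Set.range ((↑) : b → ℕ → ℚ))) = β i :=
      Subtype.ext (hf.trans (congrArg Subtype.val (Module.Basis.span_apply hli i)).symm)
    change β.repr ⟨c f, hmem f⟩ = _
    rw [this, β.repr_self]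

/-! ### Groups with independent characters of distinct prime power orders -/

theorem exists_seq_infinite_fibers (X : Type*) [Countable X] [Nonempty X] :
    ∃ J : ℕ → X, ∀ x, {n | J n = x}.Infinite := by
  obtain ⟨s, hs⟩ := exists_surjective_nat X
  refine ⟨fun n => s n.unpair.1, fun x => ?_⟩
  obtain ⟨m, rfl⟩ := hs x
  refine Set.infinite_of_injective_forall_mem (f := fun k => Nat.pair m k) ?_ fun k => by simp
  intro k l h
  simpa using h

namespace MeasFun

instance : Nonempty {a : ℚ × ℚ // a.1 < a.2} := ⟨⟨(0, 1), one_pos⟩⟩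

/-- A sequence of rational intervals in which every one occurs infinitely often. -/
noncomputable def interval : ℕ → {a : ℚ × ℚ // a.1 < a.2} :=
  (exists_seq_infinite_fibers _).choose

theorem infinite_interval_eq (a : {a : ℚ × ℚ // a.1 < a.2}) : {n | interval n = a}.Infinite :=
  (exists_seq_infinite_fibers {a : ℚ × ℚ // a.1 < a.2}).choose_spec a

/-- The sum of the step functions of values `f n` on the `n`-th interval. -/
noncomputable def circleSum : (ℕ →₀ UnitAddCircle) →+ MeasFun UnitAddCircle :=
  Finsupp.liftAddHom fun n => step (interval n).1.1 (interval n).1.2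

theorem circleSum_single (n : ℕ) (t : UnitAddCircle) :
    circleSum (Finsupp.single n t) = step (interval n).1.1 (interval n).1.2 t := by
  simp [circleSum]

/-- Intervals repeat and overlap, so steps are separated arithmetically: a multiple `N` prime to `p
n` kills the other coordinates, leaving one step, whose value must vanish. -/
theorem eq_zero_of_circleSum {p : ℕ → ℕ} (hp : ∀ n, (p n).Prime) (hinj : Function.Injective p)
    {f : ℕ →₀ UnitAddCircle} (hord : ∀ n, ∃ k, p n ^ k • f n = 0)
    (hf : ∀ U ∈ 𝓝 (0 : MeasFun UnitAddCircle), circleSum f ∈ U) : f = 0 := by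
  choose k hk using hord
  ext n
  let N := ∏ m ∈ f.support.erase n, p m ^ k m
  have hN : N • f = Finsupp.single n (N • f n) := by
    ext m
    rcases eq_or_ne m n with rfl | hmn
    · simp
    · rw [Finsupp.single_eq_of_ne hmn, Finsupp.smul_apply]
      by_cases hm : m ∈ f.support
      · obtain ⟨M, hM⟩ := Finset.dvd_prod_of_mem (fun m => p m ^ k m)
          (Finset.mem_erase.2 ⟨hmn, hm⟩)
        change N = _ at hM
        rw [hM, mul_comm, mul_smul, hk, smul_zero]
      · rw [Finsupp.notMem_support_iff.1 hm, smul_zero]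
  have hNf : ∀ U ∈ 𝓝 (0 : MeasFun UnitAddCircle),
      step (interval n).1.1 (interval n).1.2 (N • f n) ∈ U := by
    intro U hU
    rw [← circleSum_single, ← hN, map_nsmul]
    exact hf _ ((continuous_nsmul N).continuousAt.preimage_mem_nhds
      (x := (0 : MeasFun UnitAddCircle)) (by simpa using hU))
  have h0 : N • f n = 0 := by
    refine eq_zero_of_const hNf (a := (interval n).1.1) (c := (interval n).1.2)
      (by exact_mod_cast (interval n).2) fun x hx hx' => ?_
    rw [step_apply, if_pos ⟨hx, hx'⟩]
  have hcop : Nat.Coprime N (p n ^ k n) := by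
    refine Nat.Coprime.prod_left fun m hm => Nat.Coprime.pow _ _ ?_
    exact (Nat.coprime_primes (hp m) (hp n)).2 fun h => (Finset.mem_erase.1 hm).1 (hinj h)
  have hdvd := Nat.dvd_gcd (addOrderOf_dvd_of_nsmul_eq_zero h0)
    (addOrderOf_dvd_of_nsmul_eq_zero (hk n))
  rw [hcop.gcd_eq_one, Nat.dvd_one, AddMonoid.addOrderOf_eq_one_iff] at hdvd
  simpa using hdvd

/-- On a fixed short interval the image contains steps with values in the multiples of `1 / p n` for
infinitely many `n`; these values are dense in the circle. -/
theorem range_circleSum_le {G : Type*} [AddCommGroup G] (X : G →+ (ℕ →₀ UnitAddCircle))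
    {p : ℕ → ℕ} (hp : ∀ n, (p n).Prime) (hinj : Function.Injective p)
    (he : ∀ n, ∃ e, X e = Finsupp.single n (((p n : ℝ)⁻¹ : ℝ) : UnitAddCircle))
    {U : Set (MeasFun UnitAddCircle)} (hU : U ∈ 𝓝 0) :
    (circleSum.comp X).range ≤ (smallGen U (circleSum.comp X).range).topologicalClosure := by
  set S := (circleSum.comp X).range
  set C := (smallGen U S).topologicalClosure
  obtain ⟨ε, hε, hsmall⟩ := exists_step_mem hU
  have hstep : ∀ t : UnitAddCircle, ∀ a c : ℚ, a < c → step a c t ∈ C := by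
    intro t a c hac
    refine step_mem_of_short C hε hac fun a c _ hac hlt => ?_
    change step a c t ∈ closure (smallGen U S : Set (MeasFun UnitAddCircle))
    rw [mem_closure_iff_nhds]
    intro W hW
    obtain ⟨r, rfl⟩ := QuotientAddGroup.mk_surjective t
    have hcont : Continuous fun r : ℝ => step a c (r : UnitAddCircle) :=
      (continuous_step a c).comp continuous_quotient_mk'
    obtain ⟨δ, hδ, hball⟩ := Metric.mem_nhds_iff.1 (hcont.continuousAt.preimage_mem_nhds hW)
    -- The interval occurs infinitely often, while injectivity of `p` leaves only finitely many
    -- small primes.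
    obtain ⟨n, hn, hnδ⟩ : ∃ n, interval n = ⟨(a, c), hac⟩ ∧ δ⁻¹ < p n := by
      obtain ⟨M, hM⟩ := exists_nat_gt δ⁻¹
      have hfin : {n | p n ≤ M}.Finite :=
        (Set.finite_Iic M).preimage hinj.injOn
      obtain ⟨n, hn, hnM⟩ := ((infinite_interval_eq ⟨(a, c), hac⟩).sdiff hfin).nonempty
      exact ⟨n, hn, hM.trans (by exact_mod_cast not_le.1 hnM)⟩
    have hpn : (0 : ℝ) < p n := by exact_mod_cast (hp n).pos
    obtain ⟨e, hXe⟩ := he n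
    have hφe : ∀ z : ℤ, (circleSum.comp X) (z • e) =
        step a c ((z * (p n : ℝ)⁻¹ : ℝ) : UnitAddCircle) := by
      intro z
      rw [map_zsmul, AddMonoidHom.comp_apply, hXe, circleSum_single, hn, ← map_zsmul]
      congr 1
      rw [← AddCircle.coe_zsmul, zsmul_eq_mul]
    refine ⟨step a c ((⌊r * p n⌋ * (p n : ℝ)⁻¹ : ℝ) : UnitAddCircle), hball ?_, ?_⟩
    · rw [Metric.mem_ball, Real.dist_eq, ← div_eq_mul_inv]
      have h1 : (⌊r * p n⌋ : ℝ) / p n ≤ r := (div_le_iff₀ hpn).2 (Int.floor_le _)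
      have h2 : r - 1 / p n < (⌊r * p n⌋ : ℝ) / p n := by
        rw [lt_div_iff₀ hpn, sub_mul, one_div, inv_mul_cancel₀ hpn.ne']
        exact Int.sub_one_lt_floor _
      have h3 : 1 / (p n : ℝ) < δ := by
        rw [one_div]
        exact inv_lt_of_inv_lt₀ hδ hnδ
      rw [abs_lt]
      constructor <;> linarith
    · refine mem_smallGen ⟨_, hφe _⟩ fun z => ?_
      rw [← map_zsmul]
      exact hsmall a c hlt _
  rintro _ ⟨g, rfl⟩
  rw [AddMonoidHom.comp_apply]
  induction X g using Finsupp.induction_linear with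
  | zero => rw [map_zero]; exact C.zero_mem
  | add f g hf hg => rw [map_add]; exact C.add_mem hf hg
  | single n t => rw [circleSum_single]; exact hstep t _ _ (interval n).2

end MeasFun

open MeasFun in
theorem admitsSSGP_of_characters {G : Type*} [AddCommGroup G] (X : G →+ (ℕ →₀ UnitAddCircle))
    (hX : Function.Injective X) {p : ℕ → ℕ} (hp : ∀ n, (p n).Prime)
    (hinj : Function.Injective p) (hord : ∀ g n, ∃ k, p n ^ k • X g n = 0)
    (he : ∀ n, ∃ e, X e = Finsupp.single n (((p n : ℝ)⁻¹ : ℝ) : UnitAddCircle)) :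
    AdmitsSSGP G := by
  refine admitsSSGP_of_hom (circleSum.comp X) (fun g hg => hX ?_) fun U hU =>
    range_circleSum_le X hp hinj he hU
  rw [map_zero]
  exact eq_zero_of_circleSum hp hinj (hord g) hg

theorem admitsSSGP_directSum_zmod {p : ℕ → ℕ} (hp : ∀ n, (p n).Prime)
    (hinj : Function.Injective p) : AdmitsSSGP (⨁ n, ZMod (p n)) := by
  classical
  have : ∀ n, NeZero (p n) := fun n => ⟨(hp n).ne_zero⟩
  let X : (⨁ n, ZMod (p n)) →+ (ℕ →₀ UnitAddCircle) :=
    (finsuppAddEquivDFinsupp (ι := ℕ) (M := UnitAddCircle)).symm.toAddMonoidHom.comp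
      (DFinsupp.mapRange.addMonoidHom fun n => (ZMod.toAddCircle (N := p n)))
  have hXn : ∀ g n, X g n = ZMod.toAddCircle (g n) := fun g n => rfl
  refine admitsSSGP_of_characters X ?_ hp hinj (fun g n => ⟨1, ?_⟩) fun n => ?_
  · intro f g h
    ext n
    exact ZMod.toAddCircle_injective (p n)
      ((hXn f n).symm.trans ((DFunLike.congr_fun h n).trans (hXn g n)))
  · rw [hXn, ← map_nsmul, pow_one, nsmul_eq_mul, CharP.cast_eq_zero, zero_mul, map_zero]
  · refine ⟨DirectSum.of _ n 1, ?_⟩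
    ext m
    rw [hXn]
    rcases eq_or_ne m n with rfl | h
    · rw [DirectSum.of_eq_same, Finsupp.single_eq_same]
      have := ZMod.toAddCircle_intCast (N := p m) 1
      simpa using this
    · rw [DirectSum.of_eq_of_ne _ _ _ h, map_zero, Finsupp.single_eq_of_ne h]

/-! ### The primary components of `ℚ / ℤ` -/

theorem mem_ratDenomIn_of_den_dvd {P : Set ℕ} {q : ℚ} {m : ℕ} (h : q.den ∣ m)
    (hm : ∀ p : ℕ, p.Prime → p ∣ m → p ∈ P) : q ∈ ratDenomIn P :=
  fun p hp hd => hm p hp (hd.trans h)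

theorem den_div_natCast_dvd (a : ℤ) (m : ℕ) : ((a : ℚ) / m).den ∣ m := by
  have := Rat.den_dvd a m
  rw [Rat.divInt_eq_div, Int.cast_natCast] at this
  exact_mod_cast this

theorem mul_mem_ratDenomIn {P : Set ℕ} {a b : ℚ} (ha : a ∈ ratDenomIn P)
    (hb : b ∈ ratDenomIn P) : a * b ∈ ratDenomIn P := fun p hp hd =>
  ((Nat.Prime.dvd_mul hp).1 (hd.trans (Rat.mul_den_dvd a b))).elim (ha p hp) (hb p hp)

theorem inv_pow_mem_ratDenomIn {P : Set ℕ} {p : ℕ} (hp : p.Prime) (hpP : p ∈ P) (k : ℕ) :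
    ((p : ℚ) ^ k)⁻¹ ∈ ratDenomIn P := by
  refine mem_ratDenomIn_of_den_dvd (m := p ^ k) ?_ fun r hr hd => ?_
  · simpa using den_div_natCast_dvd 1 (p ^ k)
  · rwa [(Nat.prime_dvd_prime_iff_eq hr hp).1 (hr.dvd_of_dvd_pow hd)]

theorem natCast_mem_ratDenomIn (P : Set ℕ) (m : ℕ) : (m : ℚ) ∈ ratDenomIn P :=
  fun p hp hd => absurd (Nat.dvd_one.1 (by simpa using hd)) hp.ne_one

theorem exists_int_of_den {q : ℚ} (h : ∀ p : ℕ, p.Prime → ¬ p ∣ q.den) : ∃ n : ℤ, (n : ℚ) = q :=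
  ⟨q.num, Rat.coe_int_num_of_den_eq_one (Nat.eq_one_iff_not_exists_prime_dvd.2 h)⟩

/-- Partial fractions: if the denominator is `p ^ k * m` and `u * p ^ k + v * m = 1`, split the
numerator accordingly. -/
theorem exists_add_primary {p : ℕ} (hp : p.Prime) (q : ℚ) :
    ∃ a ∈ ratDenomIn {p}, ∃ b ∈ ratDenomIn {p}ᶜ, a + b = q := by
  obtain ⟨k, m, hm, hden⟩ := Nat.exists_eq_pow_mul_and_not_dvd q.den_nz p hp.ne_one
  have hm0 : m ≠ 0 := by rintro rfl; simp at hm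
  have hcop : Nat.Coprime (p ^ k) m :=
    Nat.Coprime.pow_left k ((Nat.Prime.coprime_iff_not_dvd hp).2 hm)
  obtain ⟨u, v, huv⟩ := Nat.isCoprime_iff_coprime.2 hcop
  refine ⟨((q.num * v : ℤ) : ℚ) / (p ^ k : ℕ), ?_, ((q.num * u : ℤ) : ℚ) / m, ?_, ?_⟩
  · refine mem_ratDenomIn_of_den_dvd (den_div_natCast_dvd _ _) fun r hr hd => ?_
    exact (Nat.prime_dvd_prime_iff_eq hr hp).1 (hr.dvd_of_dvd_pow hd)
  · refine mem_ratDenomIn_of_den_dvd (den_div_natCast_dvd _ _) fun r _ hd hrp => hm ?_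
    rwa [← Set.mem_singleton_iff.1 hrp]
  · have h1 : (u : ℚ) * (p ^ k : ℕ) + v * m = 1 := by exact_mod_cast huv
    have hp0 : ((p ^ k : ℕ) : ℚ) ≠ 0 := by exact_mod_cast (pow_pos hp.pos k).ne'
    have hm0' : (m : ℚ) ≠ 0 := by exact_mod_cast hm0
    have hq : q = q.num / ((p ^ k : ℕ) * m : ℚ) := by
      conv_lhs => rw [← Rat.num_div_den q, hden]
      push_cast
      rfl
    conv_rhs => rw [hq]
    rw [div_add_div _ _ hp0 hm0']
    congr 1
    push_cast at h1 ⊢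
    linear_combination (q.num : ℚ) * h1

theorem coe_eq_zero_of_mem_inf {p : ℕ} {a : ℚ} (ha : a ∈ ratDenomIn {p})
    (hb : a ∈ ratDenomIn {p}ᶜ) : ((a : ℝ) : UnitAddCircle) = 0 := by
  obtain ⟨n, rfl⟩ := exists_int_of_den fun r hr hd => hb r hr hd (ha r hr hd)
  exact (AddCircle.coe_eq_zero_iff 1).2 ⟨n, by simp⟩

/-- The `p`-primary component of the class of a rational number in `ℚ / ℤ`, as an element of the
circle. -/
noncomputable def primaryPart {p : ℕ} (hp : p.Prime) : ℚ →+ UnitAddCircle :=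
  AddMonoidHom.mk' (fun q => (((exists_add_primary hp q).choose : ℝ) : UnitAddCircle)) <| by
    intro q r
    obtain ⟨ha, b, hb, hab⟩ := (exists_add_primary hp q).choose_spec
    obtain ⟨ha', b', hb', hab'⟩ := (exists_add_primary hp r).choose_spec
    obtain ⟨ha'', b'', hb'', hab''⟩ := (exists_add_primary hp (q + r)).choose_spec
    generalize (exists_add_primary hp q).choose = a at *
    generalize (exists_add_primary hp r).choose = a' at *
    generalize (exists_add_primary hp (q + r)).choose = a'' at *
    rw [← sub_eq_zero, ← AddCircle.coe_add, ← AddCircle.coe_sub]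
    -- Both sides show that the difference has a denominator free of all primes, so it is an integer
    -- and the chosen splitting does not matter.
    have h : a'' - (a + a') = b + b' - b'' := by linarith
    have := coe_eq_zero_of_mem_inf (AddSubgroup.sub_mem _ ha'' (AddSubgroup.add_mem _ ha ha'))
      (h ▸ AddSubgroup.sub_mem _ (AddSubgroup.add_mem _ hb hb') hb'')
    simpa using this

theorem primaryPart_add {p : ℕ} (hp : p.Prime) {a b : ℚ} (ha : a ∈ ratDenomIn {p})
    (hb : b ∈ ratDenomIn {p}ᶜ) : primaryPart hp (a + b) = ((a : ℝ) : UnitAddCircle) := by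
  obtain ⟨ha', b', hb', hab'⟩ := (exists_add_primary hp (a + b)).choose_spec
  change (((exists_add_primary hp (a + b)).choose : ℝ) : UnitAddCircle) = _
  generalize (exists_add_primary hp (a + b)).choose = a' at *
  rw [← sub_eq_zero, ← AddCircle.coe_sub]
  have h : a' - a = b - b' := by linarith
  have := coe_eq_zero_of_mem_inf (AddSubgroup.sub_mem _ ha' ha)
    (h ▸ AddSubgroup.sub_mem _ hb hb')
  simpa using this

theorem primaryPart_of_mem {p : ℕ} (hp : p.Prime) {a : ℚ} (ha : a ∈ ratDenomIn {p}) :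
    primaryPart hp a = ((a : ℝ) : UnitAddCircle) := by
  simpa using primaryPart_add hp ha (ratDenomIn {p}ᶜ).zero_mem

theorem primaryPart_eq_zero_iff {p : ℕ} (hp : p.Prime) {q : ℚ} :
    primaryPart hp q = 0 ↔ ¬ p ∣ q.den := by
  constructor
  · obtain ⟨a, ha, b, hb, rfl⟩ := exists_add_primary hp q
    rw [primaryPart_add hp ha hb, AddCircle.coe_eq_zero_iff]
    rintro ⟨n, hn⟩ hd
    have han : a = n := by
      have : (n : ℝ) = a := by simpa using hn
      exact_mod_cast this.symm
    rw [han] at hd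
    exact hb p hp (by simpa using hd) rfl
  · intro h
    have hq : q ∈ ratDenomIn {p}ᶜ := fun r _ hd hr => h (Set.mem_singleton_iff.1 hr ▸ hd)
    simpa using primaryPart_add hp (ratDenomIn {p}).zero_mem hq

theorem exists_pow_smul_primaryPart {p : ℕ} (hp : p.Prime) (q : ℚ) :
    ∃ k, p ^ k • primaryPart hp q = 0 := by
  obtain ⟨a, ha, b, hb, rfl⟩ := exists_add_primary hp q
  have hden := Nat.eq_prime_pow_of_unique_prime_dvd a.den_nz fun {d} hd h => ha d hd h
  refine ⟨a.den.primeFactorsList.length, ?_⟩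
  rw [primaryPart_add hp ha hb, ← hden, ← AddCircle.coe_nsmul, AddCircle.coe_eq_zero_iff]
  refine ⟨a.num, ?_⟩
  have : (a.den : ℚ) * a = a.num := Rat.den_mul_eq_num a
  rw [zsmul_eq_mul, mul_one, nsmul_eq_mul]
  exact_mod_cast this.symm

/-- All the components of a rational number at a sequence of distinct primes. -/
noncomputable def primaryParts {p : ℕ → ℕ} (hp : ∀ n, (p n).Prime)
    (hinj : Function.Injective p) : ℚ →+ (ℕ →₀ UnitAddCircle) where
  toFun q := Finsupp.ofSupportFinite (fun n => primaryPart (hp n) q) <| by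
    refine ((Set.finite_Iic q.den).preimage hinj.injOn).subset fun n hn => ?_
    have : p n ∣ q.den := by
      by_contra h
      exact hn ((primaryPart_eq_zero_iff (hp n)).2 h)
    exact Nat.le_of_dvd q.den_pos this
  map_zero' := by ext n; exact map_zero (primaryPart (hp n))
  map_add' q r := by ext n; exact map_add (primaryPart (hp n)) q r

theorem primaryParts_apply {p : ℕ → ℕ} (hp : ∀ n, (p n).Prime) (hinj : Function.Injective p)
    (q : ℚ) (n : ℕ) : primaryParts hp hinj q n = primaryPart (hp n) q := rfl

theorem primaryParts_inv {p : ℕ → ℕ} (hp : ∀ n, (p n).Prime) (hinj : Function.Injective p)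
    (n : ℕ) : primaryParts hp hinj (p n : ℚ)⁻¹ =
      Finsupp.single n (((p n : ℝ)⁻¹ : ℝ) : UnitAddCircle) := by
  ext m
  rw [primaryParts_apply]
  rcases eq_or_ne m n with rfl | h
  · rw [Finsupp.single_eq_same, primaryPart_of_mem]
    · simp
    · simpa using inv_pow_mem_ratDenomIn (hp m) (Set.mem_singleton (p m)) 1
  · rw [Finsupp.single_eq_of_ne h, primaryPart_eq_zero_iff]
    intro hd
    have : (p n : ℚ)⁻¹ ∈ ratDenomIn {p n} := by
      simpa using inv_pow_mem_ratDenomIn (hp n) (Set.mem_singleton (p n)) 1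
    exact h (hinj (this _ (hp m) hd))

theorem exists_int_of_primaryParts_eq_zero {p : ℕ → ℕ} (hp : ∀ n, (p n).Prime)
    (hinj : Function.Injective p) {q : ℚ} (hq : q ∈ ratDenomIn (Set.range p))
    (h : primaryParts hp hinj q = 0) : ∃ n : ℤ, (n : ℚ) = q := by
  refine exists_int_of_den fun r hr hd => ?_
  obtain ⟨n, rfl⟩ := hq r hr hd
  exact (primaryPart_eq_zero_iff (hp n)).1 (DFunLike.congr_fun h n) hd

/-! ### Subgroups of `ℚ` and their quotients by `ℤ` -/

theorem exists_seq_primes {P : Set ℕ} (hP : ∀ p ∈ P, p.Prime) (hinf : P.Infinite) :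
    ∃ p : ℕ → ℕ, (∀ n, (p n).Prime) ∧ Function.Injective p ∧ Set.range p = P := by
  have hr : Set.range (Nat.nth (· ∈ P)) = P := Nat.range_nth_of_infinite hinf
  exact ⟨_, fun n => hP _ (hr.subset (Set.mem_range_self n)), Nat.nth_injective hinf, hr⟩

open MeasFun in
-- Composing the primary parts with division by `p 0 ^ k` gives a topology in which only `p 0 ^ k *
-- ℤ` is not separated from 0. These topologies grow finer with `k`, and the subgroups intersect in
-- 0.
theorem admitsSSGP_ratDenomIn {P : Set ℕ} (hP : ∀ p ∈ P, p.Prime) (hinf : P.Infinite) :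
    AdmitsSSGP (ratDenomIn P) := by
  obtain ⟨p, hp, hinj, rfl⟩ := exists_seq_primes hP hinf
  have hp0 : (p 0 : ℚ) ≠ 0 := by exact_mod_cast (hp 0).ne_zero
  let X : ℕ → ratDenomIn (Set.range p) →+ (ℕ →₀ UnitAddCircle) := fun k =>
    (primaryParts hp hinj).comp
      ((AddMonoidHom.mulRight ((p 0 : ℚ) ^ k)⁻¹).comp (ratDenomIn (Set.range p)).subtype)
  have hX : ∀ k q, X k q = primaryParts hp hinj (q * ((p 0 : ℚ) ^ k)⁻¹) := fun _ _ => rfl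
  have he : ∀ k n, ∃ e, X k e = Finsupp.single n (((p n : ℝ)⁻¹ : ℝ) : UnitAddCircle) := by
    intro k n
    refine ⟨⟨(p n : ℚ)⁻¹ * (p 0 ^ k : ℕ), mul_mem_ratDenomIn ?_ (natCast_mem_ratDenomIn _ _)⟩, ?_⟩
    · simpa using inv_pow_mem_ratDenomIn (hp n) (Set.mem_range_self n) 1
    · rw [hX, ← primaryParts_inv hp hinj]
      push_cast
      rw [mul_assoc, mul_inv_cancel₀ (pow_ne_zero k hp0), mul_one]
  refine admitsSSGP_of_antitone
    (fun k => TopologicalSpace.induced (circleSum.comp (X k)) inferInstance)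
    (antitone_nat_of_succ_le fun k => ?_) (fun k => topologicalAddGroup_induced _)
    (fun k => isSSGP_induced _ fun U hU => range_circleSum_le _ hp hinj (he k) hU) ?_
  -- The map of index `k` is the next one followed by a continuous multiplication, so it induces a
  -- coarser topology.
  · have h : ⇑(circleSum.comp (X k)) = (p 0 • ·) ∘ ⇑(circleSum.comp (X (k + 1))) := by
      funext q
      change circleSum (X k q) = p 0 • circleSum (X (k + 1) q)
      rw [← map_nsmul, hX, hX, ← map_nsmul]
      congr 2
      rw [nsmul_eq_mul, pow_succ]
      field_simp
    rw [h, ← induced_compose]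
    exact induced_mono (continuous_nsmul (p 0)).le_induced
  · intro q hq
    by_contra! hcon
    -- For this `k` the quotient `q / p 0 ^ k` would be an integer of absolute value below 1.
    obtain ⟨k, hk⟩ := pow_unbounded_of_one_lt |(q : ℚ)|
      (show (1 : ℚ) < p 0 by exact_mod_cast (hp 0).one_lt)
    have hzero : X k q = 0 := by
      refine eq_zero_of_circleSum hp hinj (fun n => exists_pow_smul_primaryPart (hp n) _)
        fun U hU => hcon k ((circleSum.comp (X k)) ⁻¹' U) ?_
      rw [nhds_induced, map_zero]
      exact Filter.preimage_mem_comap hU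
    obtain ⟨n, hn⟩ := exists_int_of_primaryParts_eq_zero hp hinj
      (mul_mem_ratDenomIn q.2 (inv_pow_mem_ratDenomIn (hp 0) (Set.mem_range_self 0) k)) hzero
    have hpos : (0 : ℚ) < (p 0 : ℚ) ^ k := pow_pos (by exact_mod_cast (hp 0).pos) k
    have hlt : |(n : ℚ)| < 1 := by
      rw [hn, ← div_eq_mul_inv, abs_div, abs_of_pos hpos, div_lt_one hpos]
      exact hk
    have hn0 : n = 0 := Int.abs_lt_one_iff.1 (by exact_mod_cast hlt)
    rw [hn0, Int.cast_zero, eq_comm, mul_eq_zero] at hn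
    exact hq (Subtype.ext (hn.resolve_right (inv_ne_zero hpos.ne')))

theorem admitsSSGP_ratDenomIn_quotient {P : Set ℕ} (hP : ∀ p ∈ P, p.Prime) (hinf : P.Infinite) :
    AdmitsSSGP
      (ratDenomIn P ⧸ (AddSubgroup.zmultiples (1 : ℚ)).addSubgroupOf (ratDenomIn P)) := by
  obtain ⟨p, hp, hinj, rfl⟩ := exists_seq_primes hP hinf
  let Y := (primaryParts hp hinj).comp (ratDenomIn (Set.range p)).subtype
  have hY : (AddSubgroup.zmultiples (1 : ℚ)).addSubgroupOf (ratDenomIn (Set.range p)) ≤ Y.ker := by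
    rintro q ⟨n, hn⟩
    refine (AddMonoidHom.mem_ker).2 ?_
    ext m
    change primaryPart (hp m) q = 0
    rw [primaryPart_eq_zero_iff]
    have : (q : ℚ) = (n : ℤ) := by simpa using hn.symm
    rw [this, Rat.den_intCast]
    exact (hp m).not_dvd_one
  refine admitsSSGP_of_characters (QuotientAddGroup.lift _ Y hY) ?_ hp hinj ?_ fun n => ?_
  · refine (injective_iff_map_eq_zero _).2 fun g hg => ?_
    obtain ⟨q, rfl⟩ := QuotientAddGroup.mk_surjective g
    obtain ⟨n, hn⟩ := exists_int_of_primaryParts_eq_zero hp hinj q.2 hg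
    exact (QuotientAddGroup.eq_zero_iff q).2 ⟨n, by simpa using hn⟩
  · intro g n
    obtain ⟨q, rfl⟩ := QuotientAddGroup.mk_surjective g
    exact exists_pow_smul_primaryPart (hp n) q
  · refine ⟨QuotientAddGroup.mk ⟨(p n : ℚ)⁻¹, ?_⟩, primaryParts_inv hp hinj n⟩
    simpa using inv_pow_mem_ratDenomIn (hp n) (Set.mem_range_self n) 1

theorem ratDenomIn_primes : ratDenomIn {p | p.Prime} = ⊤ :=
  (AddSubgroup.eq_top_iff' _).2 fun _ _ hp _ => hp

theorem admitsSSGP_rat : AdmitsSSGP ℚ :=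
  (admitsSSGP_ratDenomIn (fun _ h => h) Nat.infinite_setOfPred_prime).of_addEquiv
    (AddSubgroup.topEquiv.symm.trans (AddEquiv.addSubgroupCongr ratDenomIn_primes.symm))

theorem admitsSSGP_rat_quotient : AdmitsSSGP (ℚ ⧸ AddSubgroup.zmultiples (1 : ℚ)) := by
  refine (admitsSSGP_ratDenomIn_quotient (P := {p | p.Prime}) (fun _ h => h)
    Nat.infinite_setOfPred_prime).of_addEquiv (QuotientAddGroup.congr _ _
    (AddSubgroup.topEquiv.symm.trans (AddEquiv.addSubgroupCongr ratDenomIn_primes.symm)) ?_)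
  ext q
  exact AddSubgroup.mem_map_equiv

/-! ### Powers of finite groups -/

/-- A power of `ℤ/n` is a free module over `ℤ/n`: reduce Nöbeling's basis of the locally constant
integer functions on the Stone–Čech compactification of the discrete space `Λ`. -/
theorem free_pi_zmod (n : ℕ) [NeZero n] (Λ : Type*) : Module.Free (ZMod n) (Λ → ZMod n) := by
  let S := Ultrafilter Λ
  have : Module.Free ℤ (LocallyConstant S ℤ) :=
    LocallyConstant.freeOfProfinite (Profinite.of S)
  let β := Module.Free.chooseBasis ℤ (LocallyConstant S ℤ)
  let ρ : LocallyConstant S ℤ →+ (Λ → ZMod n) :=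
    { toFun := fun f x => (f (pure x) : ZMod n)
      map_zero' := by funext x; simp
      map_add' := fun f g => by funext x; simp }
  have hρ : ∀ f x, ρ f x = (f (pure x) : ZMod n) := fun _ _ => rfl
  have hker : ∀ f, ρ f = 0 → ∃ g, f = (n : ℤ) • g := by
    intro f hf
    -- Divisibility by `n` holds at principal ultrafilters and spreads to all, as these are dense
    -- and `f` is locally constant.
    refine ⟨f.map (· / n), LocallyConstant.ext fun u => ?_⟩
    have hd : (n : ℤ) ∣ f u := by
      have hopen : IsOpen (f ⁻¹' {f u}) := f.isLocallyConstant.isOpen_fiber (f u)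
      obtain ⟨x, hx⟩ := denseRange_pure.exists_mem_open hopen ⟨u, rfl⟩
      rw [← show f (pure x) = f u from hx]
      exact (ZMod.intCast_zmod_eq_zero_iff_dvd _ n).1 (congrFun hf x)
    exact (Int.mul_ediv_cancel' hd).symm
  have hsurj : ∀ h : Λ → ZMod n, ∃ f, ρ f = h := by
    intro h
    let _ : TopologicalSpace (ZMod n) := ⊥
    have : DiscreteTopology (ZMod n) := ⟨rfl⟩
    let k : LocallyConstant S (ZMod n) := ⟨Ultrafilter.extend h,
      (IsLocallyConstant.iff_continuous _).2 (continuous_ultrafilter_extend h)⟩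
    refine ⟨k.map fun a => (a.val : ℤ), funext fun x => ?_⟩
    rw [hρ]
    change (((Ultrafilter.extend h (pure x)).val : ℤ) : ZMod n) = h x
    rw [show Ultrafilter.extend h (pure x) = h x from congrFun (ultrafilter_extend_extends h) x]
    simp
  -- A relation modulo `n` lifts to an integer combination in the kernel of `ρ`, which is `n` times
  -- another function; comparing coordinates makes each coefficient divisible by `n`.
  have hli : LinearIndependent (ZMod n) fun i => ρ (β i) := by
    rw [linearIndependent_iff']
    intro s c hc i hi
    let f := ∑ j ∈ s, ((c j).val : ℤ) • β j
    have hf : ρ f = 0 := by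
      rw [← hc, map_sum]
      refine Finset.sum_congr rfl fun j _ => funext fun x => ?_
      rw [map_zsmul]
      simp
    obtain ⟨g, hg⟩ := hker f hf
    have hi' : ((c i).val : ℤ) = n * β.repr g i := by
      have h1 : β.repr f i = ((c i).val : ℤ) := by
        simp only [f, map_sum, map_smul, Module.Basis.repr_self, Finsupp.coe_finsetSum,
          Finset.sum_apply, Finsupp.smul_apply, Finsupp.single_apply, smul_eq_mul]
        simp [hi]
      rw [← h1, hg, map_smul, Finsupp.smul_apply, smul_eq_mul]
    have := congrArg (fun z : ℤ => (z : ZMod n)) hi'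
    simpa using this
  have hspan : ⊤ ≤ Submodule.span (ZMod n) (Set.range fun i => ρ (β i)) := by
    rintro h -
    obtain ⟨f, rfl⟩ := hsurj h
    have hf := β.linearCombination_repr f
    rw [← hf, Finsupp.linearCombination_apply, Finsupp.sum, map_sum]
    refine Submodule.sum_mem _ fun i _ => ?_
    rw [map_zsmul]
    exact zsmul_mem (Submodule.subset_span (Set.mem_range_self i)) _
  exact Module.Free.of_basis (Module.Basis.mk hli hspan)

/-- By freeness the power is a direct sum of copies of `ZMod n`; there are infinitely many, as a
finite basis would make the power finite. -/
theorem admitsSSGP_pi_zmod {n : ℕ} (hn : 1 < n) (Λ : Type*) [Infinite Λ] :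
    AdmitsSSGP (Λ → ZMod n) := by
  have : NeZero n := ⟨by lia⟩
  have : Fact (1 < n) := ⟨hn⟩
  have := free_pi_zmod n Λ
  let β := Module.Free.chooseBasis (ZMod n) (Λ → ZMod n)
  have : Infinite (Module.Free.ChooseBasisIndex (ZMod n) (Λ → ZMod n)) := by
    by_contra hfin
    rw [not_infinite_iff_finite] at hfin
    have : Finite (Λ → ZMod n) := Finite.of_injective β.equivFun β.equivFun.injective
    exact not_finite (Λ → ZMod n)
  exact (admitsSSGP_finsupp (ZMod n) _).of_addEquiv β.repr.toAddEquiv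

theorem admitsSSGP_pi_finite (F Λ : Type*) [AddCommGroup F] [Finite F] [Infinite Λ] :
    AdmitsSSGP (Λ → F) := by
  classical
  obtain ⟨ι, _, n, hn, ⟨e⟩⟩ := AddCommGroup.equiv_directSum_zmod_of_finite' F
  let e' : F ≃+ (∀ i, ZMod (n i)) := e.trans (DirectSum.addEquivProd _)
  let e'' : (Λ → F) ≃+ (∀ i, Λ → ZMod (n i)) :=
    { toFun := fun f i x => e' (f x) i
      invFun := fun g x => e'.symm fun i => g i x
      left_inv := fun f => funext fun x => e'.symm_apply_apply (f x)
      right_inv := fun g => by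
        funext i x
        exact congrFun (e'.apply_symm_apply _) i
      map_add' := fun f g => by
        funext i x
        exact congrFun (map_add e' (f x) (g x)) i }
  exact (admitsSSGP_directSum_and_pi fun i =>
    admitsSSGP_pi_zmod (hn i) Λ).2.of_addEquiv e''

theorem admitsSSGP_directSum_const (G Λ : Type*) [AddCommGroup G] [Infinite Λ] :
    AdmitsSSGP (⨁ _ : Λ, G) := by
  classical
  exact (admitsSSGP_finsupp G Λ).of_addEquiv (finsuppAddEquivDFinsupp (ι := Λ) (M := G)).symm

theorem mainTheorem9 :
    -- `ℚ`, and its subgroups with infinitely many primes and their powers as denominators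
    (AdmitsSSGP ℚ ∧
      ∀ P : Set ℕ, (∀ p ∈ P, p.Prime) → P.Infinite → AdmitsSSGP (ratDenomIn P)) ∧
    -- the quotients of these groups by `ℤ`
    (AdmitsSSGP (ℚ ⧸ AddSubgroup.zmultiples (1 : ℚ)) ∧
      ∀ P : Set ℕ, (∀ p ∈ P, p.Prime) → P.Infinite →
        AdmitsSSGP
          (ratDenomIn P ⧸ (AddSubgroup.zmultiples (1 : ℚ)).addSubgroupOf (ratDenomIn P))) ∧
    -- direct sums of cyclic groups of prime orders that all coincide or all differ
    (∀ p : ℕ → ℕ, (∀ i, (p i).Prime) → ((∀ i j, p i = p j) ∨ Function.Injective p) →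
      AdmitsSSGP (⨁ i, ZMod (p i))) ∧
    -- `ℤ^(ω)` and `ℤ^ω`
    AdmitsSSGP (ℕ →₀ ℤ) ∧
    AdmitsSSGP (ℕ → ℤ) ∧
    -- `G^(Λ)`
    (∀ (G : Type u₁) [AddCommGroup G] [Nontrivial G] (Λ : Type u₂) [Infinite Λ],
      AdmitsSSGP (Λ →₀ G)) ∧
    -- `F^Λ`
    (∀ (F : Type u₃) [AddCommGroup F] [Nontrivial F] [Finite F] (Λ : Type u₄) [Infinite Λ],
      AdmitsSSGP (Λ → F)) ∧
    -- arbitrary direct sums and products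
    (∀ (I : Type u₅) (G : I → Type u₆) [∀ i, AddCommGroup (G i)],
      (∀ i, AdmitsSSGP (G i)) → AdmitsSSGP (⨁ i, G i) ∧ AdmitsSSGP (∀ i, G i)) := by
  refine ⟨⟨admitsSSGP_rat, fun P => admitsSSGP_ratDenomIn⟩,
    ⟨admitsSSGP_rat_quotient, fun P => admitsSSGP_ratDenomIn_quotient⟩, ?_,
    admitsSSGP_finsupp ℤ ℕ, admitsSSGP_pi_int, fun G _ _ Λ _ => admitsSSGP_finsupp G Λ,
    fun F _ _ _ Λ _ => admitsSSGP_pi_finite F Λ, fun I G _ h => admitsSSGP_directSum_and_pi h⟩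
  rintro p hp (h | h)
  · obtain ⟨q, rfl⟩ : ∃ q, p = fun _ => q := ⟨p 0, funext fun i => h i 0⟩
    exact admitsSSGP_directSum_const (ZMod q) ℕ
  · exact admitsSSGP_directSum_zmod hp h
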